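/- Let $G$ be a connected simple graph on $[n]=\{1,\dots,n\}$, $n\ge 1$, and let $R=\mathbb{C}[x_1,\dots,x_n,y_1,\dots,y_n]$. Put $f_{i,j}=x_iy_j-x_jy_i$, and for a simple graph $H$ on $[n]$ (or on a subset of $[n]$) let $J_H=(f_{i,j} : \{i,j\}\in E(H),\ i<j)\subseteq R$ be its binomial edge ideal. For $\mathcal S\subseteq[n]$ let $G_1,\dots,G_{c(\mathcal S)}$ be the connected components of the induced subgraph $G_{[n]\setminus\mathcal S}$, let $\widetilde G_i$ be the complete graph on $V(G_i)$, and set $$P_{\mathcal S}=(x_i,y_i : i\in\mathcal S)+J_{\widetilde G_1}+\dots+J_{\widetilde G_{c(\mathcal S)}}.$$ A vertex $i$ of a graph $H$ is a cut point of $H$ if $H$ has fewer connected components than the graph obtained from $H$ by deleting $i$. A nonempty set $\mathcal S\subsetneq[n]$ is a minimal $k$-cut of $G$ if $G_{[n]\setminus\mathcal S}$ has exactly $k$ connected components and every $i\in\mathcal S$ is a cut point of $G_{([n]\setminus\mathcal S)\cup\{i\}}$. Let $\min(G)$ consist of $\emptyset$ and all minimal $k$-cuts of $G$ with $k\ge2$.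 For $\mathcal S\subseteq[n]$ let $M(\mathcal S)$ be the matroid on $[n]$, of rank at most two, whose dependent sets are $$\mathcal D(M(\mathcal S))=\{B\subseteq[n] : B\cap\mathcal S\ne\emptyset\}\cup\bigcup_{i}\{B\subseteq[n] : |B\cap V(G_i)|\ge2\}\cup\{B\subseteq[n] : |B|\ge3\}.$$ For $\mathcal S\in\min(G)$ let $\Delta_{\mathcal S}=\{\mathcal D(M(\mathcal S'))\setminus\mathcal D(M(\mathcal S)) : \mathcal S'\in\min(G)\setminus\{\mathcal S\}\}$, and let $\mathcal T(\mathcal S)$ be the set of transversals of $\Delta_{\mathcal S}$, that is, of all $A\subseteq\bigcup_{e\in\Delta_{\mathcal S}}e$ with $A\cap e\neq\emptyset$ for every $e\in\Delta_{\mathcal S}$. Every member of such an $A$ is a subset of $[n]$ with one or two elements; write $A=A_1\amalg A_2$, where $A_1$ collects the one-element members, identified with a subset of $[n]$, and $A_2$ the two-element members. For a decomposition $A_1=C\amalg D$ into disjoint, possibly empty, sets put $$g_{A,C,D}=\prod_{k\in C}x_k\prod_{k\in D}y_k\prod_{\{i,j\}\in A_2,\ i<j}f_{i,j},$$ and let $J_{\mathcal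 T(\mathcal S)}=(g_{A,C,D} : A\in\mathcal T(\mathcal S),\ C\amalg D=A_1)$. **Theorem 3.2.** For every $\mathcal S\in\min(G)$, $$(J_G:P_{\mathcal S})=\sqrt{J_G+J_{\mathcal T(\mathcal S)}}.$$ -/

import Mathlib

noncomputable section

namespace BinomialEdge

open MvPolynomial

/-- The polynomial ring `ℂ[x₁, …, xₙ, y₁, …, yₙ]`. -/
abbrev Poly (n : ℕ) : Type := MvPolynomial (Fin n ⊕ Fin n) ℂ

/-- The variable `xᵢ`. -/
def x {n : ℕ} (i : Fin n) : Poly n := X (Sum.inl i)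

/-- The variable `yᵢ`. -/
def y {n : ℕ} (i : Fin n) : Poly n := X (Sum.inr i)

/-- The binomial `f_{i,j} = xᵢ yⱼ - xⱼ yᵢ`. -/
def f {n : ℕ} (i j : Fin n) : Poly n := x i * y j - x j * y i

/-- The binomial edge ideal `J_G = (f_{i,j} : {i,j} ∈ E(G), i < j)`. -/
def edgeIdeal {n : ℕ} (G : SimpleGraph (Fin n)) : Ideal (Poly n) :=
  Ideal.span {p | ∃ i j : Fin n, i < j ∧ G.Adj i j ∧ p = f i j}

/-- The connected components of the induced subgraph `G_W`. -/
abbrev Comp {n : ℕ} (G : SimpleGraph (Fin n)) (W : Set (Fin n)) : Type :=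
  (G.induce W).ConnectedComponent

/-- The vertex set, as a set of vertices of `G`, of a connected component of `G_W`. -/
def compVerts {n : ℕ} {G : SimpleGraph (Fin n)} {W : Set (Fin n)} (c : Comp G W) :
    Set (Fin n) :=
  Subtype.val '' c.supp

/-- The number of connected components of the induced subgraph `G_W`. -/
def numComp {n : ℕ} (G : SimpleGraph (Fin n)) (W : Set (Fin n)) : ℕ :=
  Nat.card (Comp G W)

/-- The complete graph on `V ⊆ [n]` (the vertices outside `V` are isolated). -/
def completeOn {n : ℕ} (V : Set (Fin n)) : SimpleGraph (Fin n) where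
  Adj i j := i ∈ V ∧ j ∈ V ∧ i ≠ j
  symm := ⟨fun _ _ h => ⟨h.2.1, h.1, h.2.2.symm⟩⟩
  loopless := ⟨fun _ h => h.2.2 rfl⟩

/-- The ideal `P_S = (xᵢ, yᵢ : i ∈ S) + ∑ J_{K(V(G_c))}`, the sum being over the connected
components `G_c` of `G_{[n] ∖ S}`, where `K(V)` is the complete graph on `V`. -/
def primeIdeal {n : ℕ} (G : SimpleGraph (Fin n)) (S : Finset (Fin n)) : Ideal (Poly n) :=
  Ideal.span {p | ∃ i ∈ S, p = x i ∨ p = y i} ⊔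
    ⨆ c : Comp G {v | v ∉ S}, edgeIdeal (completeOn (compVerts c))

/-- `i` is a cut point of the induced subgraph `G_W`: it is a vertex of `G_W`, and `G_W` has
fewer connected components than `G_{W ∖ {i}}`. -/
def IsCutPoint {n : ℕ} (G : SimpleGraph (Fin n)) (W : Set (Fin n)) (i : Fin n) : Prop :=
  i ∈ W ∧ numComp G W < numComp G (W \ {i})

/-- `S` is a minimal `k`-cut of `G`: a nonempty proper subset of `[n]` such that `G_{[n] ∖ S}` has
exactly `k` connected components and every `i ∈ S` is a cut point of `G_{([n] ∖ S) ∪ {i}}`. -/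
def IsMinimalCut {n : ℕ} (G : SimpleGraph (Fin n)) (k : ℕ) (S : Finset (Fin n)) : Prop :=
  S.Nonempty ∧ S ≠ Finset.univ ∧ numComp G {v | v ∉ S} = k ∧
    ∀ i ∈ S, IsCutPoint G ({v | v ∉ S} ∪ {i}) i

/-- `min(G)`: the minimal `k`-cuts of `G` with `k ≥ 2`, together with the empty set. -/
def minCuts {n : ℕ} (G : SimpleGraph (Fin n)) : Set (Finset (Fin n)) :=
  {S | (∃ k, 2 ≤ k ∧ IsMinimalCut G k S) ∨ S = ∅}

/-- The condition defining the dependent sets of `M(S)`: `B` meets `S`, or contains at least two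
vertices of one connected component of `G_{[n] ∖ S}`, or has at least three elements. -/
def IsDependent {n : ℕ} (G : SimpleGraph (Fin n)) (S : Finset (Fin n)) (B : Set (Fin n)) :
    Prop :=
  (B ∩ ↑S).Nonempty ∨ (∃ c : Comp G {v | v ∉ S}, 2 ≤ (B ∩ compVerts c).ncard) ∨ 3 ≤ B.ncard

/-- Two vertices lying in a common connected component of `G_{[n] ∖ S}`. -/
def SameComp {n : ℕ} (G : SimpleGraph (Fin n)) (S : Finset (Fin n)) (u v : Fin n) : Prop :=
  ∃ c : Comp G {v | v ∉ S}, u ∈ compVerts c ∧ v ∈ compVerts c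

theorem eq_of_mem_compVerts {n : ℕ} {G : SimpleGraph (Fin n)} {W : Set (Fin n)}
    {c d : Comp G W} {v : Fin n} (hc : v ∈ compVerts c) (hd : v ∈ compVerts d) : c = d := by
  obtain ⟨a, ha, rfl⟩ := hc
  obtain ⟨b, hb, hab⟩ := hd
  obtain rfl := Subtype.ext hab
  exact ha.symm.trans hb

theorem SameComp.trans {n : ℕ} {G : SimpleGraph (Fin n)} {S : Finset (Fin n)} {u v w : Fin n}
    (h : SameComp G S u v) (h' : SameComp G S v w) : SameComp G S u w := by
  obtain ⟨c, hu, hv⟩ := h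
  obtain ⟨d, hv', hw⟩ := h'
  obtain rfl := eq_of_mem_compVerts hv hv'
  exact ⟨c, hu, hw⟩

theorem SameComp.symm {n : ℕ} {G : SimpleGraph (Fin n)} {S : Finset (Fin n)} {u v : Fin n}
    (h : SameComp G S u v) : SameComp G S v u := by
  obtain ⟨c, hu, hv⟩ := h
  exact ⟨c, hv, hu⟩

theorem SameComp.refl {n : ℕ} {G : SimpleGraph (Fin n)} {S : Finset (Fin n)} {v : Fin n}
    (h : v ∉ S) : SameComp G S v v := by
  have : v ∈ compVerts ((G.induce {v | v ∉ S}).connectedComponentMk ⟨v, h⟩) :=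
    ⟨⟨v, h⟩, rfl, rfl⟩
  exact ⟨_, this, this⟩

theorem not_isDependent_iff {n : ℕ} {G : SimpleGraph (Fin n)} {S : Finset (Fin n)}
    {B : Set (Fin n)} :
    ¬ IsDependent G S B ↔ (∀ v ∈ B, v ∉ S) ∧
      (∀ u ∈ B, ∀ v ∈ B, SameComp G S u v → u = v) ∧ B.ncard ≤ 2 := by
  unfold IsDependent
  rw [not_or, not_or]
  refine and_congr ?_ (and_congr ?_ (by omega))
  · rw [Set.not_nonempty_iff_eq_empty, Set.eq_empty_iff_forall_notMem]
    simp
  · constructor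
    · rintro h u hu v hv ⟨c, hc, hc'⟩
      by_contra huv
      refine h ⟨c, ?_⟩
      rw [← Set.ncard_pair huv]
      refine Set.ncard_le_ncard ?_ (Set.toFinite _)
      rintro w (rfl | rfl)
      exacts [⟨hu, hc⟩, ⟨hv, hc'⟩]
    · rintro h ⟨c, hc⟩
      obtain ⟨u, hu, v, hv, huv⟩ := (Set.one_lt_ncard_iff_nontrivial).1 (show 1 < _ from hc)
      exact huv (h u hu.1 v hv.1 ⟨c, hu.2, hv.2⟩)

/-- The matroid `M(S)` of rank at most two on `[n]`, whose dependent sets are those described by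
`IsDependent`. -/
def cutMatroid {n : ℕ} (G : SimpleGraph (Fin n)) (S : Finset (Fin n)) : Matroid (Fin n) :=
  (IndepMatroid.ofFinite (E := Set.univ) Set.finite_univ (fun B => ¬ IsDependent G S B)
    (by rw [not_isDependent_iff]; simp)
    (by
      intro I J hJ hIJ
      rw [not_isDependent_iff] at hJ ⊢
      exact ⟨fun v hv => hJ.1 v (hIJ hv), fun u hu v hv => hJ.2.1 u (hIJ hu) v (hIJ hv),
        (Set.ncard_le_ncard hIJ (Set.toFinite _)).trans hJ.2.2⟩)
    (by
      intro I J hI hJ hlt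
      by_contra! hcon
      have key : ∀ e ∈ J, ∃ a ∈ I, SameComp G S e a := by
        intro e he
        rw [not_isDependent_iff] at hI hJ
        by_contra! hno
        have heI : e ∉ I := fun h => hno e h (SameComp.refl (hJ.1 e he))
        refine (not_isDependent_iff.2 ⟨?_, ?_, ?_⟩) (hcon e he heI)
        · rintro v (rfl | hv)
          exacts [hJ.1 _ he, hI.1 v hv]
        · rintro u (rfl | hu) v (rfl | hv) huv
          · rfl
          · exact absurd huv (hno v hv)
          · exact absurd huv.symm (hno u hu)
          · exact hI.2.1 u hu v hv huv
        · exact (Set.ncard_insert_le e I).trans (by omega)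
      choose! g hg hg' using key
      obtain ⟨u, hu, v, hv, huv, hne⟩ :=
        Set.exists_ne_map_eq_of_ncard_lt_of_maps_to hlt hg (Set.toFinite _)
      rw [not_isDependent_iff] at hJ
      exact huv (hJ.2.1 u hu v hv ((hg' u hu).trans (hne ▸ (hg' v hv).symm))))
    (fun _ _ => Set.subset_univ _)).matroid

theorem cutMatroid_dep_iff {n : ℕ} {G : SimpleGraph (Fin n)} {S : Finset (Fin n)}
    {B : Set (Fin n)} : (cutMatroid G S).Dep B ↔ IsDependent G S B := by
  simp [Matroid.Dep, cutMatroid]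

/-- `𝒟(M(S))`: the collection of dependent sets of `M(S)`. -/
def depSets {n : ℕ} (G : SimpleGraph (Fin n)) (S : Finset (Fin n)) : Set (Finset (Fin n)) :=
  {B | (cutMatroid G S).Dep (B : Set (Fin n))}

/-- `Δ_S = {𝒟(M(S')) ∖ 𝒟(M(S)) : S' ∈ min(G) ∖ {S}}`. -/
def diffFamily {n : ℕ} (G : SimpleGraph (Fin n)) (S : Finset (Fin n)) :
    Set (Set (Finset (Fin n))) :=
  {e | ∃ S' ∈ minCuts G, S' ≠ S ∧ e = depSets G S' \ depSets G S}

/-- `A` is a transversal of `Δ`: a (finite) subset of `⋃ Δ` meeting every member of `Δ`. -/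
def IsTransversal {E : Type*} (Δ : Set (Set E)) (A : Finset E) : Prop :=
  (A : Set E) ⊆ ⋃₀ Δ ∧ ∀ e ∈ Δ, ((A : Set E) ∩ e).Nonempty

/-- `𝒯(S)`: the transversals of `Δ_S`. -/
def transversals {n : ℕ} (G : SimpleGraph (Fin n)) (S : Finset (Fin n)) :
    Set (Finset (Finset (Fin n))) :=
  {A | IsTransversal (diffFamily G S) A}

/-- `A₁`: the one-element members of `A`, identified with a subset of `[n]`. -/
def singles {n : ℕ} (A : Finset (Finset (Fin n))) : Finset (Fin n) :=
  Finset.univ.filter fun i => {i} ∈ A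

/-- `A₂`: the two-element members `{i, j}` of `A`, each listed once, as `(i, j)` with `i < j`. -/
def pairs {n : ℕ} (A : Finset (Finset (Fin n))) : Finset (Fin n × Fin n) :=
  Finset.univ.filter fun p => p.1 < p.2 ∧ {p.1, p.2} ∈ A

/-- `g_{A,C,D} = ∏_{k ∈ C} x_k ∏_{k ∈ D} y_k ∏_{{i,j} ∈ A₂} f_{i,j}`. -/
def g {n : ℕ} (A : Finset (Finset (Fin n))) (C D : Finset (Fin n)) : Poly n :=
  (∏ k ∈ C, x k) * (∏ k ∈ D, y k) * ∏ p ∈ pairs A, f p.1 p.2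

/-- `J_{𝒯(S)} = (g_{A,C,D} : A ∈ 𝒯(S), C ⨿ D = A₁)`. -/
def transversalIdeal {n : ℕ} (G : SimpleGraph (Fin n)) (S : Finset (Fin n)) : Ideal (Poly n) :=
  Ideal.span {p | ∃ A ∈ transversals G S, ∃ C D : Finset (Fin n),
    Disjoint C D ∧ C ∪ D = singles A ∧ p = g A C D}

end BinomialEdge

end

/-!
The proof describes all prime ideals containing `J_G`. Such a prime `Q` contains some `P_S` with
`S` in `min(G)` (`exists_mem_minCuts_primeIdeal_le`): take for `S` the set of vertices whose two
variables lie in `Q`; modulo `Q`, being proportional is transitive on nonzero columns, so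
`P_S ⊆ Q`, and a vertex of `S` that is not a cut point can be dropped from `S`. The ideals `P_S` are
prime (`primeIdeal_isPrime`), being preimages of kernels of monomial parametrisations
(`ker_toricMap`), and incomparable for different `S` in `min(G)` (`eq_of_primeIdeal_le`).

Moreover `J_G` is radical (`relIdeal_isRadical`). No Gröbner basis is needed: for a vertex `v`,
the ideal `J_G` is the intersection of `J_{G_v}` and `(x_v, y_v) + J_{G - v}`, where `G_v` completes
the neighbourhood of `v` to a clique. Indeed `x_v` and `y_v` multiply `f_{i,j}` into `J_G` when `i`
and `j` are neighbours of `v`, so modulo `J_G` an element of `J_{G_v}` may be assumed free of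
`x_v` and `y_v`, and one may then set these variables to zero. Induction on the number of vertices
whose neighbourhood is not a clique leads to disjoint unions of complete graphs, whose ideals are
prime. Hence `J_G` is the intersection of the `P_T`, `T` in `min(G)`, and `J_G : P_S` is the
intersection of those with `T ≠ S`.

It remains to see that the primes containing `J_G + J_{𝒯(S)}` are those containing some `P_T` with
`T ≠ S` in `min(G)`. A transversal has a member that is dependent for `T`, and the corresponding
factor of `g_{A,C,D}` lies in `P_T` (`transversalIdeal_le_primeIdeal`). Conversely, if a prime `Q`
over `J_G` contains no such `P_T`, then `P_S ⊆ Q`, and the sets of one or two columns that are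
independent modulo `Q` supply a transversal `A` and a product `g_{A,C,D}` outside `Q`
(`exists_ne_primeIdeal_le`).
-/

namespace BinomialEdge

open MvPolynomial

/-! ### Ideals generated by binomials indexed by a relation -/

/-- The ideal generated by the `f_{i,j}` with `r i j`, for an arbitrary relation `r`. Allowing
reflexive relations costs nothing since `f_{i,i} = 0`, and lets equivalence relations appear. -/
noncomputable def relIdeal {n : ℕ} (r : Fin n → Fin n → Prop) : Ideal (Poly n) :=
  Ideal.span {p | ∃ i j, r i j ∧ p = f i j}

theorem f_self {n : ℕ} (i : Fin n) : f i i = 0 := by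
  simp [f]

theorem f_swap {n : ℕ} (i j : Fin n) : f i j = -f j i := by
  simp only [f]; ring

theorem f_mem_relIdeal {n : ℕ} {r : Fin n → Fin n → Prop} {i j : Fin n} (h : r i j) :
    f i j ∈ relIdeal r :=
  Ideal.subset_span ⟨i, j, h, rfl⟩

theorem relIdeal_le_iff {n : ℕ} {r : Fin n → Fin n → Prop} {I : Ideal (Poly n)} :
    relIdeal r ≤ I ↔ ∀ i j, r i j → f i j ∈ I := by
  rw [relIdeal, Ideal.span_le]
  constructor
  · exact fun h i j hij => h ⟨i, j, hij, rfl⟩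
  · rintro h _ ⟨i, j, hij, rfl⟩
    exact h i j hij

theorem edgeIdeal_le_iff {n : ℕ} {G : SimpleGraph (Fin n)} {I : Ideal (Poly n)} :
    edgeIdeal G ≤ I ↔ ∀ i j, G.Adj i j → f i j ∈ I := by
  rw [edgeIdeal, Ideal.span_le]
  constructor
  · intro h i j hij
    rcases lt_or_gt_of_ne hij.ne with hlt | hlt
    · exact h ⟨i, j, hlt, hij, rfl⟩
    · rw [f_swap]
      exact I.neg_mem (h ⟨j, i, hlt, hij.symm, rfl⟩)
  · rintro h _ ⟨i, j, -, hij, rfl⟩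
    exact h i j hij

/-- The ideal `(xᵢ, yᵢ : i ∈ S)`. -/
noncomputable def varIdeal {n : ℕ} (S : Finset (Fin n)) : Ideal (Poly n) :=
  Ideal.span {p | ∃ i ∈ S, p = x i ∨ p = y i}

theorem x_mem_varIdeal {n : ℕ} {S : Finset (Fin n)} {i : Fin n} (h : i ∈ S) :
    x i ∈ varIdeal S :=
  Ideal.subset_span ⟨i, h, Or.inl rfl⟩

theorem y_mem_varIdeal {n : ℕ} {S : Finset (Fin n)} {i : Fin n} (h : i ∈ S) :
    y i ∈ varIdeal S :=
  Ideal.subset_span ⟨i, h, Or.inr rfl⟩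

theorem varIdeal_le_iff {n : ℕ} {S : Finset (Fin n)} {I : Ideal (Poly n)} :
    varIdeal S ≤ I ↔ ∀ i ∈ S, x i ∈ I ∧ y i ∈ I := by
  rw [varIdeal, Ideal.span_le]
  constructor
  · exact fun h i hi => ⟨h ⟨i, hi, Or.inl rfl⟩, h ⟨i, hi, Or.inr rfl⟩⟩
  · rintro h _ ⟨i, hi, rfl | rfl⟩
    exacts [(h i hi).1, (h i hi).2]

/-! ### Setting the variables of a set of vertices to zero -/

/-- The substitution `xᵢ, yᵢ ↦ 0` for `i ∈ S`, fixing the other variables. -/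
noncomputable def kill {n : ℕ} (S : Finset (Fin n)) : Poly n →ₐ[ℂ] Poly n :=
  aeval fun v => if Sum.elim id id v ∈ S then 0 else X v

theorem kill_x {n : ℕ} (S : Finset (Fin n)) (i : Fin n) :
    kill S (x i) = if i ∈ S then 0 else x i := by
  rw [kill, x, aeval_X]
  rfl

theorem kill_y {n : ℕ} (S : Finset (Fin n)) (i : Fin n) :
    kill S (y i) = if i ∈ S then 0 else y i := by
  rw [kill, y, aeval_X]
  rfl

theorem kill_f_of_mem {n : ℕ} {S : Finset (Fin n)} {i j : Fin n} (h : i ∈ S ∨ j ∈ S) :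
    kill S (f i j) = 0 := by
  rcases h with h | h <;> simp [f, kill_x, kill_y, h]

theorem kill_f_of_notMem {n : ℕ} {S : Finset (Fin n)} {i j : Fin n} (hi : i ∉ S) (hj : j ∉ S) :
    kill S (f i j) = f i j := by
  simp [f, kill_x, kill_y, hi, hj]

theorem sub_kill_mem {n : ℕ} (S : Finset (Fin n)) (p : Poly n) :
    p - kill S p ∈ varIdeal S := by
  induction p using MvPolynomial.induction_on with
  | C a => simp [kill, MvPolynomial.algebraMap_eq]
  | add p q hp hq =>
    rw [map_add, add_sub_add_comm]
    exact add_mem hp hq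
  | mul_X p v hp =>
    have hv : X v - kill S (X v) ∈ varIdeal S := by
      rcases v with i | i
      · change x i - kill S (x i) ∈ _
        rw [kill_x]
        split_ifs with h
        · simpa using x_mem_varIdeal h
        · simp
      · change y i - kill S (y i) ∈ _
        rw [kill_y]
        split_ifs with h
        · simpa using y_mem_varIdeal h
        · simp
    have : p * X v - kill S (p * X v) =
        (p - kill S p) * X v + kill S p * (X v - kill S (X v)) := by
      rw [map_mul]; ring
    rw [this]
    exact add_mem (Ideal.mul_mem_right _ _ hp) (Ideal.mul_mem_left _ _ hv)

theorem varIdeal_sup_relIdeal {n : ℕ} (S : Finset (Fin n)) (r : Fin n → Fin n → Prop) :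
    varIdeal S ⊔ relIdeal r = (relIdeal r).comap (kill S) := by
  apply le_antisymm
  · refine sup_le (varIdeal_le_iff.2 fun i hi => ?_) (relIdeal_le_iff.2 fun i j hij => ?_)
    · simp [Ideal.mem_comap, kill_x, kill_y, hi]
    · rw [Ideal.mem_comap]
      by_cases h : i ∈ S ∨ j ∈ S
      · rw [kill_f_of_mem h]
        exact zero_mem _
      · rw [not_or] at h
        rw [kill_f_of_notMem h.1 h.2]
        exact f_mem_relIdeal hij
  · intro p hp
    rw [← sub_add_cancel p (kill S p)]
    exact add_mem (Ideal.mem_sup_left (sub_kill_mem S p)) (Ideal.mem_sup_right hp)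

/-! ### The ideal of an equivalence relation is prime -/

section Toric

variable {n : ℕ} {κ : Type*}

/-- The exponent of the image of a variable under the parametrisation
`xᵢ ↦ zᵢ s_{c i}`, `yᵢ ↦ zᵢ t_{c i}`; the variables `z`, `s`, `t` are indexed by the three
summands. -/
noncomputable def toricWeight (c : Fin n → κ) : Fin n ⊕ Fin n → (Fin n ⊕ κ ⊕ κ →₀ ℕ)
  | .inl i => Finsupp.single (.inl i) 1 + Finsupp.single (.inr (.inl (c i))) 1
  | .inr i => Finsupp.single (.inl i) 1 + Finsupp.single (.inr (.inr (c i))) 1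

/-- The linear map on exponents induced by `toricWeight`. -/
noncomputable def toricExp (c : Fin n → κ) :
    (Fin n ⊕ Fin n →₀ ℕ) →ₗ[ℕ] (Fin n ⊕ κ ⊕ κ →₀ ℕ) :=
  Finsupp.linearCombination ℕ (toricWeight c)

/-- The parametrisation `xᵢ ↦ zᵢ s_{c i}`, `yᵢ ↦ zᵢ t_{c i}` of the variety of the ideal
generated by the `f_{i,j}` with `c i = c j`. -/
noncomputable def toricMap (c : Fin n → κ) : Poly n →ₐ[ℂ] MvPolynomial (Fin n ⊕ κ ⊕ κ) ℂ :=
  aeval fun v => monomial (toricWeight c v) 1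

theorem toricMap_monomial (c : Fin n → κ) (m : Fin n ⊕ Fin n →₀ ℕ) (a : ℂ) :
    toricMap c (monomial m a) = monomial (toricExp c m) a := by
  rw [toricMap, aeval_monomial, toricExp, Finsupp.linearCombination_apply,
    monomial_finsupp_sum_index]
  simp [monomial_pow, MvPolynomial.algebraMap_eq]

theorem toricMap_f (c : Fin n → κ) {i j : Fin n} (h : c i = c j) : toricMap c (f i j) = 0 := by
  simp only [f, x, y, toricMap, map_sub, map_mul, aeval_X, monomial_mul, toricWeight, h]
  rw [sub_eq_zero]
  congr 2
  abel

theorem exists_of_toricExp_ne_zero {c : Fin n → κ} {m : Fin n ⊕ Fin n →₀ ℕ}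
    {a : Fin n ⊕ κ ⊕ κ} (h : toricExp c m a ≠ 0) : ∃ v, m v ≠ 0 ∧ toricWeight c v a ≠ 0 := by
  by_contra! hcon
  apply h
  rw [toricExp, Finsupp.linearCombination_apply, Finsupp.sum, Finsupp.coe_finsetSum,
    Finset.sum_apply]
  refine Finset.sum_eq_zero fun v hv => ?_
  simp [hcon v (Finsupp.mem_support_iff.1 hv)]

theorem exists_add_single {σ : Type*} {m : σ →₀ ℕ} {v : σ} (h : m v ≠ 0) :
    ∃ m', m = m' + Finsupp.single v 1 :=
  ⟨m - Finsupp.single v 1, (tsub_add_cancel_of_le (by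
    rw [Finsupp.single_le_iff]; exact Nat.one_le_iff_ne_zero.2 h)).symm⟩

/-- A variable whose weight divides the image of a monomial divides, modulo the binomials, the
monomial itself: if it does not divide it outright, one exchange `xⱼ yᵢ ↔ xᵢ yⱼ` makes it do so. -/
theorem exists_exchange (c : Fin n → κ) (m : Fin n ⊕ Fin n →₀ ℕ) (v : Fin n ⊕ Fin n)
    (h : ∀ a, toricWeight c v a ≠ 0 → toricExp c m a ≠ 0) :
    ∃ m', (monomial m (1 : ℂ) - monomial (m' + Finsupp.single v 1) 1 : Poly n) ∈
      relIdeal fun i j => c i = c j := by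
  by_cases hv : m v ≠ 0
  · obtain ⟨m', rfl⟩ := exists_add_single hv
    exact ⟨m', by simp⟩
  rw [not_not] at hv
  classical
  have key : ∀ (m' : Fin n ⊕ Fin n →₀ ℕ) (u w u' w' : Fin n ⊕ Fin n),
      (monomial (m' + Finsupp.single u 1 + Finsupp.single w 1) (1 : ℂ) -
        monomial (m' + Finsupp.single u' 1 + Finsupp.single w' 1) 1 : Poly n) =
      monomial m' 1 * (X u * X w - X u' * X w') := by
    intro m' u w u' w'
    simp only [X, mul_sub, monomial_mul, mul_one, add_assoc]
  rcases v with i | i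
  · obtain ⟨u, hu, hu'⟩ := exists_of_toricExp_ne_zero (h (.inl i) (by simp [toricWeight]))
    obtain ⟨w, hw, hw'⟩ := exists_of_toricExp_ne_zero
      (h (.inr (.inl (c i))) (by simp [toricWeight]))
    obtain rfl : u = .inr i := by
      rcases u with u | u <;> simp [toricWeight, Finsupp.single_apply] at hu' <;> subst hu' <;>
        simp_all
    obtain ⟨j, rfl, hj⟩ : ∃ j, w = .inl j ∧ c j = c i := by
      rcases w with w | w <;> simp [toricWeight, Finsupp.single_apply] at hw'
      exact ⟨w, rfl, hw'⟩
    obtain ⟨m₁, rfl⟩ := exists_add_single hu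
    obtain ⟨m₂, rfl⟩ := exists_add_single (m := m₁) (v := .inl j) (by simpa using hw)
    refine ⟨m₂ + Finsupp.single (.inr j) 1, ?_⟩
    rw [key]
    refine Ideal.mul_mem_left _ _ ?_
    convert f_mem_relIdeal (r := fun i j => c i = c j) hj using 1
    simp only [f, x, y]; ring
  · obtain ⟨u, hu, hu'⟩ := exists_of_toricExp_ne_zero (h (.inl i) (by simp [toricWeight]))
    obtain ⟨w, hw, hw'⟩ := exists_of_toricExp_ne_zero
      (h (.inr (.inr (c i))) (by simp [toricWeight]))
    obtain rfl : u = .inl i := by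
      rcases u with u | u <;> simp [toricWeight, Finsupp.single_apply] at hu' <;> subst hu' <;>
        simp_all
    obtain ⟨j, rfl, hj⟩ : ∃ j, w = .inr j ∧ c j = c i := by
      rcases w with w | w <;> simp [toricWeight, Finsupp.single_apply] at hw'
      exact ⟨w, rfl, hw'⟩
    obtain ⟨m₁, rfl⟩ := exists_add_single hu
    obtain ⟨m₂, rfl⟩ := exists_add_single (m := m₁) (v := .inr j) (by simpa using hw)
    refine ⟨m₂ + Finsupp.single (.inl j) 1, ?_⟩
    rw [key]
    refine Ideal.mul_mem_left _ _ ?_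
    convert f_mem_relIdeal (r := fun i j => c i = c j) hj.symm using 1
    simp only [f, x, y]; ring

theorem toricMap_eq_zero_of_mem (c : Fin n → κ) {p : Poly n}
    (hp : p ∈ relIdeal fun i j => c i = c j) : toricMap c p = 0 := by
  have : relIdeal (fun i j => c i = c j) ≤ RingHom.ker (toricMap c) :=
    relIdeal_le_iff.2 fun i j h => toricMap_f c h
  exact this hp

theorem monomial_sub_mem_of_toricExp_eq (c : Fin n → κ) (m m' : Fin n ⊕ Fin n →₀ ℕ)
    (h : toricExp c m = toricExp c m') :
    (monomial m (1 : ℂ) - monomial m' 1 : Poly n) ∈ relIdeal fun i j => c i = c j := by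
  induction hN : m.degree generalizing m m' with
  | zero =>
    obtain rfl : m = 0 := (Finsupp.degree_eq_zero_iff m).1 hN
    obtain rfl : m' = 0 := by
      by_contra hne
      obtain ⟨v, hv⟩ := Finsupp.ne_iff.1 hne
      obtain ⟨m₁, rfl⟩ := exists_add_single hv
      have hv' : ∃ a, toricWeight c v a ≠ 0 := by
        rcases v with i | i <;> exact ⟨.inl i, by simp [toricWeight]⟩
      obtain ⟨a, ha⟩ := hv'
      have := DFunLike.congr_fun h a
      simp only [toricExp, map_zero, map_add, Finsupp.linearCombination_single, one_smul,
        Finsupp.add_apply, Finsupp.coe_zero, Pi.zero_apply] at this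
      omega
    simp
  | succ N ih =>
    have hm : m ≠ 0 := by rintro rfl; simp at hN
    obtain ⟨v, hv⟩ := Finsupp.ne_iff.1 hm
    obtain ⟨m₁, rfl⟩ := exists_add_single hv
    have hw : ∀ m₂, toricExp c (m₂ + Finsupp.single v 1) = toricExp c m₂ + toricWeight c v := by
      intro m₂; simp [toricExp]
    obtain ⟨m₂, hm₂⟩ := exists_exchange c m' v (by
      intro a ha
      rw [← h, hw, Finsupp.add_apply]
      omega)
    have hexp : toricExp c m' = toricExp c (m₂ + Finsupp.single v 1) := by
      have := toricMap_eq_zero_of_mem c hm₂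
      rw [map_sub, toricMap_monomial, toricMap_monomial, sub_eq_zero] at this
      exact monomial_left_injective one_ne_zero this
    have := ih m₁ m₂ (by
      rw [hexp, hw, hw] at h
      exact add_right_cancel h) (by simpa [map_add] using hN)
    have h' := Ideal.mul_mem_right (X v : Poly n) _ this
    rw [sub_mul, X, monomial_mul, monomial_mul, mul_one] at h'
    simpa using sub_mem h' hm₂

/-- The binomials generate the whole kernel of the parametrisation: sending a monomial to the
class of any of its preimages is a linear section modulo the binomials. -/
theorem ker_toricMap (c : Fin n → κ) :
    RingHom.ker (toricMap c) = relIdeal fun i j => c i = c j := by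
  refine le_antisymm (fun p hp => ?_) fun p hp => toricMap_eq_zero_of_mem c hp
  let I : Ideal (Poly n) := relIdeal fun i j => c i = c j
  let σ : MvPolynomial (Fin n ⊕ κ ⊕ κ) ℂ →ₗ[ℂ] Poly n ⧸ I :=
    (basisMonomials _ ℂ).constr ℂ fun w =>
      Ideal.Quotient.mk I (monomial (Function.invFun (toricExp c) w) 1)
  have hσ : σ ∘ₗ (toricMap c).toLinearMap = (Ideal.Quotient.mkₐ ℂ I).toLinearMap := by
    refine (basisMonomials _ ℂ).ext fun m => ?_
    have h1 : σ (monomial (toricExp c m) 1) =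
        Ideal.Quotient.mk I (monomial (Function.invFun (toricExp c) (toricExp c m)) 1) := by
      have := (basisMonomials (Fin n ⊕ κ ⊕ κ) ℂ).constr_basis ℂ (fun w =>
        Ideal.Quotient.mk I (monomial (Function.invFun (toricExp c) w) 1)) (toricExp c m)
      rwa [coe_basisMonomials] at this
    simp only [coe_basisMonomials, LinearMap.comp_apply, AlgHom.toLinearMap_apply,
      toricMap_monomial, h1, Ideal.Quotient.mkₐ_eq_mk]
    exact Ideal.Quotient.eq.2
      (monomial_sub_mem_of_toricExp_eq c _ _ (Function.invFun_eq ⟨m, rfl⟩))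
  have hp' := LinearMap.congr_fun hσ p
  have hp0 : toricMap c p = 0 := hp
  simp only [LinearMap.comp_apply, AlgHom.toLinearMap_apply, hp0, map_zero,
    Ideal.Quotient.mkₐ_eq_mk] at hp'
  exact Ideal.Quotient.eq_zero_iff_mem.1 hp'.symm

end Toric

theorem relIdeal_isPrime {n : ℕ} {r : Fin n → Fin n → Prop} (hr : Equivalence r) :
    (relIdeal r).IsPrime := by
  have h : (fun i j => Quotient.mk ⟨r, hr⟩ i = Quotient.mk ⟨r, hr⟩ j) = r := by
    ext i j
    exact Quotient.eq
  rw [← h, ← ker_toricMap]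
  exact RingHom.ker_isPrime _

/-! ### Binomial edge ideals are radical -/

/-- `v` is simplicial for `r`: its neighbours are pairwise related. -/
def IsSimplicial {n : ℕ} (r : Fin n → Fin n → Prop) (v : Fin n) : Prop :=
  ∀ i j, r v i → r v j → r i j

/-- The relation `r` with the neighbourhood of `v` completed to a clique. -/
def completeAt {n : ℕ} (r : Fin n → Fin n → Prop) (v i j : Fin n) : Prop :=
  r i j ∨ (r v i ∧ r v j)

/-- The relation `r` with `v` isolated; the loops are kept, so that reflexivity is preserved. -/
def isolate {n : ℕ} (r : Fin n → Fin n → Prop) (v i j : Fin n) : Prop :=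
  i = j ∨ (r i j ∧ i ≠ v ∧ j ≠ v)

theorem isSimplicial_completeAt {n : ℕ} {r : Fin n → Fin n → Prop} (hsymm : ∀ i j, r i j → r j i)
    {v w : Fin n} (h : w = v ∨ IsSimplicial r w) : IsSimplicial (completeAt r v) w := by
  intro i j hi hj
  rcases h with rfl | h
  · exact Or.inr ⟨hi.elim id And.right, hj.elim id And.right⟩
  · rcases hi with hi | hi <;> rcases hj with hj | hj
    · exact Or.inl (h i j hi hj)
    · exact Or.inr ⟨h v i (hsymm _ _ hj.1) hi, hj.2⟩
    · exact Or.inr ⟨hi.2, h v j (hsymm _ _ hi.1) hj⟩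
    · exact Or.inr ⟨hi.2, hj.2⟩

theorem isSimplicial_isolate {n : ℕ} {r : Fin n → Fin n → Prop} (hsymm : ∀ i j, r i j → r j i)
    {v w : Fin n} (h : w = v ∨ IsSimplicial r w) : IsSimplicial (isolate r v) w := by
  rintro i j (rfl | ⟨hi, hwv, hiv⟩) (rfl | ⟨hj, hwv', hjv⟩)
  · exact Or.inl rfl
  · exact Or.inr ⟨hj, hwv', hjv⟩
  · exact Or.inr ⟨hsymm _ _ hi, hiv, hwv⟩
  · rcases h with rfl | h
    · exact absurd rfl hwv
    · exact Or.inr ⟨h i j hi hj, hiv, hjv⟩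

theorem kill_mem_relIdeal_isolate {n : ℕ} {r : Fin n → Fin n → Prop} (v : Fin n) {p : Poly n}
    (hp : p ∈ relIdeal r) : kill {v} p ∈ relIdeal (isolate r v) := by
  have : relIdeal r ≤ (relIdeal (isolate r v)).comap (kill {v}) := by
    refine relIdeal_le_iff.2 fun i j hij => ?_
    rw [Ideal.mem_comap]
    by_cases h : i ∈ ({v} : Finset (Fin n)) ∨ j ∈ ({v} : Finset (Fin n))
    · rw [kill_f_of_mem h]
      exact zero_mem _
    · rw [not_or] at h
      rw [kill_f_of_notMem h.1 h.2]
      exact f_mem_relIdeal (Or.inr ⟨hij, by simpa using h.1, by simpa using h.2⟩)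
  exact this hp

theorem relIdeal_isolate_le {n : ℕ} {r : Fin n → Fin n → Prop} (v : Fin n) :
    relIdeal (isolate r v) ≤ relIdeal r := by
  refine relIdeal_le_iff.2 fun i j hij => ?_
  rcases hij with rfl | hij
  · rw [f_self]
    exact zero_mem _
  · exact f_mem_relIdeal hij.1

/-- The variables at `v` multiply the binomials of pairs of neighbours of `v` into the ideal of `r`,
so modulo that ideal the coefficients of those binomials may be taken free of `x_v`, `y_v`. -/
theorem sub_kill_mem_of_mem_completeAt {n : ℕ} {r : Fin n → Fin n → Prop}
    (hsymm : ∀ i j, r i j → r j i) (v : Fin n) {p : Poly n}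
    (hp : p ∈ relIdeal (completeAt r v)) : p - kill {v} p ∈ relIdeal r := by
  have hgen : ∀ i j, r i j → ∀ a : Poly n, a * f i j - kill {v} (a * f i j) ∈ relIdeal r := by
    intro i j hij a
    have h := Ideal.mul_mem_left _ a (f_mem_relIdeal hij)
    exact sub_mem h (relIdeal_isolate_le v (kill_mem_relIdeal_isolate v h))
  refine Submodule.span_induction
    (p := fun p _ => ∀ a : Poly n, a * p - kill {v} (a * p) ∈ relIdeal r) ?_ ?_ ?_ ?_ hp 1
    |> fun h => by simpa using h
  · rintro _ ⟨i, j, hij, rfl⟩ a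
    rcases hij with hij | ⟨hi, hj⟩
    · exact hgen i j hij a
    by_cases hiv : i = v
    · subst hiv
      exact hgen _ _ hj a
    by_cases hjv : j = v
    · subst hjv
      exact hgen _ _ (hsymm _ _ hi) a
    rw [map_mul, kill_f_of_notMem (by simpa using hiv) (by simpa using hjv), ← sub_mul, mul_comm]
    have hle : varIdeal {v} ≤ (relIdeal r).colon {f i j} := by
      refine varIdeal_le_iff.2 fun k hk => ?_
      obtain rfl := Finset.mem_singleton.1 hk
      have h1 := f_mem_relIdeal hi
      have h2 := f_mem_relIdeal hj
      rw [Submodule.mem_colon_singleton, Submodule.mem_colon_singleton, smul_eq_mul, smul_eq_mul]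
      constructor
      · have : x k * f i j = x i * f k j - x j * f k i := by simp only [f]; ring
        rw [this]
        exact sub_mem (Ideal.mul_mem_left _ _ h2) (Ideal.mul_mem_left _ _ h1)
      · have : y k * f i j = y i * f k j - y j * f k i := by simp only [f]; ring
        rw [this]
        exact sub_mem (Ideal.mul_mem_left _ _ h2) (Ideal.mul_mem_left _ _ h1)
    have := hle (sub_kill_mem {v} a)
    rwa [Submodule.mem_colon_singleton, smul_eq_mul, mul_comm] at this
  · simp
  · intro p q _ _ hp hq a
    rw [mul_add, map_add, add_sub_add_comm]
    exact add_mem (hp a) (hq a)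
  · intro b p _ hp a
    rw [smul_eq_mul, ← mul_assoc]
    exact hp (a * b)

/-- The ideal of `r` is the intersection of the ideal of `completeAt r v` with the preimage of the
ideal of `isolate r v` under `x_v, y_v ↦ 0`. -/
theorem mem_relIdeal_of_completeAt_of_isolate {n : ℕ} {r : Fin n → Fin n → Prop}
    (hsymm : ∀ i j, r i j → r j i) (v : Fin n) {p : Poly n}
    (hp : p ∈ relIdeal (completeAt r v)) (hp' : kill {v} p ∈ relIdeal (isolate r v)) :
    p ∈ relIdeal r := by
  rw [← sub_add_cancel p (kill {v} p)]
  exact add_mem (sub_kill_mem_of_mem_completeAt hsymm v hp) (relIdeal_isolate_le v hp')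

theorem relIdeal_isRadical {n : ℕ} (r : Fin n → Fin n → Prop) (hrefl : ∀ i, r i i)
    (hsymm : ∀ i j, r i j → r j i) : (relIdeal r).IsRadical := by
  -- Both `completeAt r v` and `isolate r v` have fewer non-simplicial vertices than `r`.
  induction hN : {v | ¬ IsSimplicial r v}.ncard using Nat.strong_induction_on generalizing r with
  | _ N ih =>
    by_cases hall : ∀ v, IsSimplicial r v
    · exact (relIdeal_isPrime ⟨hrefl, hsymm _ _,
        fun {i j k} hij hjk => hall j i k (hsymm _ _ hij) hjk⟩).isRadical
    push Not at hall
    obtain ⟨v, hv⟩ := hall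
    have hlt : ∀ r' : Fin n → Fin n → Prop, (∀ w, w = v ∨ IsSimplicial r w → IsSimplicial r' w) →
        {w | ¬ IsSimplicial r' w}.ncard < N := by
      intro r' h
      rw [← hN]
      refine Set.ncard_lt_ncard ⟨fun w hw hw' => hw (h w (Or.inr hw')), fun hsub => ?_⟩
        (Set.toFinite _)
      exact hsub hv (h v (Or.inl rfl))
    have hc : (relIdeal (completeAt r v)).IsRadical :=
      ih _ (hlt _ fun w => isSimplicial_completeAt hsymm) _ (fun i => Or.inl (hrefl i))
        (fun i j h => h.imp (hsymm _ _) And.symm) rfl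
    have hd : (relIdeal (isolate r v)).IsRadical :=
      ih _ (hlt _ fun w => isSimplicial_isolate hsymm) _ (fun i => Or.inl rfl)
        (fun i j h => h.imp Eq.symm fun h => ⟨hsymm _ _ h.1, h.2.2, h.2.1⟩) rfl
    rintro p ⟨k, hk⟩
    refine mem_relIdeal_of_completeAt_of_isolate hsymm v (hc ⟨k, ?_⟩) (hd ⟨k, ?_⟩)
    · exact relIdeal_le_iff.2 (fun i j hij => f_mem_relIdeal (Or.inl hij)) hk
    · rw [← map_pow]
      exact kill_mem_relIdeal_isolate v hk

theorem edgeIdeal_isRadical {n : ℕ} (G : SimpleGraph (Fin n)) : (edgeIdeal G).IsRadical := by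
  have : edgeIdeal G = relIdeal fun i j => i = j ∨ G.Adj i j := by
    apply le_antisymm
    · exact edgeIdeal_le_iff.2 fun i j hij => f_mem_relIdeal (Or.inr hij)
    · refine relIdeal_le_iff.2 fun i j hij => ?_
      rcases hij with rfl | hij
      · rw [f_self]
        exact zero_mem _
      · exact edgeIdeal_le_iff.1 le_rfl i j hij
  rw [this]
  exact relIdeal_isRadical _ (fun i => Or.inl rfl) fun i j h => h.imp Eq.symm fun h => h.symm

/-! ### Connected components of induced subgraphs -/

/-- `u` and `v` are joined by a path of `G` inside `W`. -/
def Linked {n : ℕ} (G : SimpleGraph (Fin n)) (W : Set (Fin n)) (u v : Fin n) : Prop :=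
  u ∈ W ∧ Relation.ReflTransGen (fun a b => G.Adj a b ∧ b ∈ W) u v

section Linked

variable {n : ℕ} {G : SimpleGraph (Fin n)} {W U : Set (Fin n)} {u v w i : Fin n}

theorem Linked.mem_right (h : Linked G W u v) : v ∈ W := by
  obtain ⟨hu, h⟩ := h
  cases h with
  | refl => exact hu
  | tail _ h => exact h.2

theorem Linked.trans (h : Linked G W u v) (h' : Linked G W v w) : Linked G W u w :=
  ⟨h.1, h.2.trans h'.2⟩

theorem Linked.of_adj (hu : u ∈ W) (hv : v ∈ W) (h : G.Adj u v) : Linked G W u v :=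
  ⟨hu, .single ⟨h, hv⟩⟩

theorem mk_eq_mk_iff_linked (hu : u ∈ W) (hv : v ∈ W) :
    (G.induce W).connectedComponentMk ⟨u, hu⟩ = (G.induce W).connectedComponentMk ⟨v, hv⟩ ↔
      Linked G W u v := by
  rw [SimpleGraph.ConnectedComponent.eq, SimpleGraph.reachable_iff_reflTransGen]
  constructor
  · exact fun h => ⟨hu, h.lift Subtype.val fun a b hab => ⟨hab, b.2⟩⟩
  · rintro ⟨-, h⟩
    induction h with
    | refl => exact .refl
    | @tail b c hab hbc ih => exact (ih (Linked.mem_right ⟨hu, hab⟩)).tail hbc.1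

theorem sameComp_iff_linked {S : Finset (Fin n)} :
    SameComp G S u v ↔ Linked G {v | v ∉ S} u v := by
  constructor
  · rintro ⟨c, ⟨a, ha, rfl⟩, ⟨b, hb, rfl⟩⟩
    exact (mk_eq_mk_iff_linked a.2 b.2).1 (ha.trans hb.symm)
  · intro h
    refine ⟨(G.induce _).connectedComponentMk ⟨u, h.1⟩, ⟨⟨u, h.1⟩, rfl, rfl⟩,
      ⟨⟨v, h.mem_right⟩, ?_, rfl⟩⟩
    exact ((mk_eq_mk_iff_linked h.1 h.mem_right).2 h).symm

/-- A path through `i` can be rerouted when all neighbours of `i` are linked. -/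
theorem Linked.of_insert (hi : i ∉ U)
    (hn : ∀ u ∈ U, ∀ w ∈ U, G.Adj i u → G.Adj i w → Linked G U u w)
    (hu : u ∈ U) (hv : v ∈ U) (h : Linked G (insert i U) u v) : Linked G U u v := by
  have key : (v ≠ i → Linked G U u v) ∧ (v = i → ∃ w ∈ U, G.Adj i w ∧ Linked G U u w) := by
    clear hv
    obtain ⟨-, h⟩ := h
    induction h with
    | refl => exact ⟨fun _ => ⟨hu, .refl⟩, fun h => absurd (h ▸ hu) hi⟩
    | @tail b c _ hbc ih =>
      refine ⟨fun hc => ?_, ?_⟩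
      · have hcU : c ∈ U := hbc.2.resolve_left hc
        by_cases hb : b = i
        · obtain ⟨w, hw, hiw, huw⟩ := ih.2 hb
          exact huw.trans (hn w hw c hcU hiw (hb ▸ hbc.1))
        · exact (ih.1 hb).trans (.of_adj (ih.1 hb).mem_right hcU hbc.1)
      · rintro rfl
        have hb := ih.1 hbc.1.ne
        exact ⟨b, hb.mem_right, hbc.1.symm, hb⟩
  exact key.1 fun h => hi (h ▸ hv)

/-- Adding a vertex to an induced subgraph lowers the number of components exactly when it joins
two of them. -/
theorem numComp_insert_lt_iff (hi : i ∉ U) :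
    numComp G (insert i U) < numComp G U ↔
      ∃ u ∈ U, ∃ w ∈ U, G.Adj i u ∧ G.Adj i w ∧ ¬ Linked G U u w := by
  let φ : Comp G U → Comp G (insert i U) := fun c =>
    c.map (G.induceHomOfLE (Set.subset_insert i U)).toHom
  have hφ : ∀ a : U, φ ((G.induce U).connectedComponentMk a) =
      (G.induce (insert i U)).connectedComponentMk ⟨a, Set.mem_insert_of_mem _ a.2⟩ :=
    fun a => rfl
  constructor
  · intro hlt
    by_contra! hn
    refine hlt.not_ge (Nat.card_le_card_of_injective φ ?_)
    intro c d
    refine SimpleGraph.ConnectedComponent.ind₂ (fun a b hab => ?_) c d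
    rw [hφ, hφ, mk_eq_mk_iff_linked] at hab
    exact (mk_eq_mk_iff_linked a.2 b.2).2 (hab.of_insert hi hn a.2 b.2)
  · rintro ⟨u, hu, w, hw, hiu, hiw, huw⟩
    have hsurj : Function.Surjective φ := by
      refine SimpleGraph.ConnectedComponent.ind fun ⟨a, ha⟩ => ?_
      rcases ha with rfl | ha
      · refine ⟨(G.induce U).connectedComponentMk ⟨u, hu⟩, ?_⟩
        exact (hφ _).trans ((mk_eq_mk_iff_linked _ _).2
          (.of_adj (Set.mem_insert_of_mem _ hu) (Set.mem_insert _ _) hiu.symm))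
      · exact ⟨(G.induce U).connectedComponentMk ⟨a, ha⟩, rfl⟩
    refine (Nat.card_le_card_of_surjective φ hsurj).lt_of_ne fun heq => huw ?_
    have hinj := (hsurj.bijective_of_nat_card_le heq.ge).1
    rw [← mk_eq_mk_iff_linked hu hw]
    apply hinj
    rw [hφ, hφ, mk_eq_mk_iff_linked]
    exact Linked.trans (v := i)
      (.of_adj (Set.mem_insert_of_mem _ hu) (Set.mem_insert _ _) hiu.symm)
      (.of_adj (Set.mem_insert _ _) (Set.mem_insert_of_mem _ hw) hiw)

theorem isCutPoint_iff {S : Finset (Fin n)} (hi : i ∈ S) :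
    IsCutPoint G ({v | v ∉ S} ∪ {i}) i ↔
      ∃ u, u ∉ S ∧ ∃ w, w ∉ S ∧ G.Adj i u ∧ G.Adj i w ∧ ¬ SameComp G S u w := by
  have hi' : i ∉ {v | v ∉ S} := fun h => h hi
  rw [IsCutPoint, Set.union_singleton, Set.insert_sdiff_self_of_notMem hi',
    numComp_insert_lt_iff hi']
  simp only [Set.mem_insert_iff, true_or, true_and, sameComp_iff_linked, Set.mem_ofPred_eq]

end Linked

/-! ### The prime ideals containing a binomial edge ideal -/

section Primes

variable {n : ℕ} {G : SimpleGraph (Fin n)} {S T : Finset (Fin n)} {i j u w : Fin n}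

theorem primeIdeal_eq (G : SimpleGraph (Fin n)) (S : Finset (Fin n)) :
    primeIdeal G S = varIdeal S ⊔ relIdeal (SameComp G S) := by
  have h : (⨆ c : Comp G {v | v ∉ S}, edgeIdeal (completeOn (compVerts c))) =
      relIdeal (SameComp G S) := by
    apply le_antisymm
    · refine iSup_le fun c => edgeIdeal_le_iff.2 fun i j hij => ?_
      exact f_mem_relIdeal ⟨c, hij.1, hij.2.1⟩
    · refine relIdeal_le_iff.2 fun i j ⟨c, hi, hj⟩ => ?_
      by_cases hij : i = j
      · rw [hij, f_self]
        exact zero_mem _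
      · exact Submodule.mem_iSup_of_mem c (edgeIdeal_le_iff.1 le_rfl i j ⟨hi, hj, hij⟩)
  rw [primeIdeal, h, varIdeal]

theorem primeIdeal_le_iff {I : Ideal (Poly n)} : primeIdeal G S ≤ I ↔
    (∀ i ∈ S, x i ∈ I ∧ y i ∈ I) ∧ ∀ i j, SameComp G S i j → f i j ∈ I := by
  rw [primeIdeal_eq, sup_le_iff, varIdeal_le_iff, relIdeal_le_iff]

theorem x_mem_primeIdeal (h : i ∈ S) : x i ∈ primeIdeal G S :=
  ((primeIdeal_le_iff.1 le_rfl).1 i h).1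

theorem y_mem_primeIdeal (h : i ∈ S) : y i ∈ primeIdeal G S :=
  ((primeIdeal_le_iff.1 le_rfl).1 i h).2

theorem f_mem_primeIdeal (h : i ∈ S ∨ j ∈ S ∨ SameComp G S i j) : f i j ∈ primeIdeal G S := by
  rcases h with h | h | h
  · exact sub_mem (Ideal.mul_mem_right _ _ (x_mem_primeIdeal h))
      (Ideal.mul_mem_left _ _ (y_mem_primeIdeal h))
  · exact sub_mem (Ideal.mul_mem_left _ _ (y_mem_primeIdeal h))
      (Ideal.mul_mem_right _ _ (x_mem_primeIdeal h))
  · exact (primeIdeal_le_iff.1 le_rfl).2 i j h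

theorem primeIdeal_isPrime (G : SimpleGraph (Fin n)) (S : Finset (Fin n)) :
    (primeIdeal G S).IsPrime := by
  have h : relIdeal (SameComp G S) = relIdeal fun i j => i = j ∨ SameComp G S i j := by
    refine le_antisymm (relIdeal_le_iff.2 fun i j hij => f_mem_relIdeal (Or.inr hij))
      (relIdeal_le_iff.2 fun i j hij => ?_)
    rcases hij with rfl | hij
    · rw [f_self]
      exact zero_mem _
    · exact f_mem_relIdeal hij
  rw [primeIdeal_eq, h, varIdeal_sup_relIdeal]
  have := relIdeal_isPrime (r := fun i j => i = j ∨ SameComp G S i j)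
    ⟨fun i => Or.inl rfl, fun h => h.imp Eq.symm SameComp.symm, by
      rintro i j k (rfl | hij) (rfl | hjk)
      exacts [Or.inl rfl, Or.inr hjk, Or.inr hij, Or.inr (hij.trans hjk)]⟩
  exact Ideal.comap_isPrime _ _

theorem edgeIdeal_le_primeIdeal (G : SimpleGraph (Fin n)) (S : Finset (Fin n)) :
    edgeIdeal G ≤ primeIdeal G S := by
  refine edgeIdeal_le_iff.2 fun i j hij => f_mem_primeIdeal ?_
  by_cases hi : i ∈ S
  · exact Or.inl hi
  by_cases hj : j ∈ S
  · exact Or.inr (Or.inl hj)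
  exact Or.inr (Or.inr (sameComp_iff_linked.2 (.of_adj hi hj hij)))

/-- Some point of the zero set of `primeIdeal G S` has the column `(1, 0)` at `u` and the column
`(0, 1)` at all vertices outside `S` and outside the component of `u`. -/
theorem exists_point (hu : u ∉ S) : ∃ e : Poly n →+* ℂ, (∀ p ∈ primeIdeal G S, e p = 0) ∧
    e (x u) = 1 ∧ e (y u) = 0 ∧
      ∀ w, w ∉ S → ¬ SameComp G S u w → e (x w) = 0 ∧ e (y w) = 1 := by
  classical
  let e : Poly n →+* ℂ := eval (Sum.elim (fun i => if SameComp G S u i then 1 else 0)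
    fun i => if i ∈ S ∨ SameComp G S u i then 0 else 1)
  have hx : ∀ i, e (x i) = if SameComp G S u i then 1 else 0 := fun i => by simp [e, x]
  have hy : ∀ i, e (y i) = if i ∈ S ∨ SameComp G S u i then 0 else 1 := fun i => by simp [e, y]
  refine ⟨e, ?_, ?_, ?_, ?_⟩
  · have hle : primeIdeal G S ≤ RingHom.ker e := by
      refine primeIdeal_le_iff.2 ⟨fun i hi => ?_, fun i j hij => ?_⟩
      · have : ¬ SameComp G S u i := fun h => (sameComp_iff_linked.1 h).mem_right hi
        simp [RingHom.mem_ker, hx, hy, this, hi]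
      · have hi : i ∉ S := (sameComp_iff_linked.1 hij).1
        have hj : j ∉ S := (sameComp_iff_linked.1 hij).mem_right
        have : SameComp G S u i ↔ SameComp G S u j :=
          ⟨fun h => h.trans hij, fun h => h.trans hij.symm⟩
        simp [RingHom.mem_ker, f, hx, hy, this, hi, hj]
    exact fun p hp => hle hp
  · simp [hx, SameComp.refl hu]
  · simp [hy, SameComp.refl hu]
  · intro w hw huw
    simp [hx, hy, hw, huw]

theorem mem_of_x_mem_primeIdeal (h : x i ∈ primeIdeal G S) : i ∈ S := by
  by_contra hi
  obtain ⟨e, he, hx, -⟩ := exists_point (G := G) hi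
  exact one_ne_zero (hx.symm.trans (he _ h))

theorem sameComp_of_f_mem_primeIdeal (hu : u ∉ S) (hw : w ∉ S) (h : f u w ∈ primeIdeal G S) :
    SameComp G S u w := by
  by_contra huw
  obtain ⟨e, he, hx, hy, hw'⟩ := exists_point (G := G) hu
  obtain ⟨h1, h2⟩ := hw' w hw huw
  have := he _ h
  simp [f, hx, h1, h2] at this

theorem exists_adj_of_mem_minCuts (hS : S ∈ minCuts G) (hi : i ∈ S) :
    ∃ u, u ∉ S ∧ ∃ w, w ∉ S ∧ G.Adj i u ∧ G.Adj i w ∧ ¬ SameComp G S u w := by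
  rcases hS with ⟨k, -, -, -, -, h⟩ | rfl
  · exact (isCutPoint_iff hi).1 (h i hi)
  · simp at hi

/-- The ideals `primeIdeal G S`, for `S` in `minCuts G`, are pairwise incomparable. A vertex
`i ∈ T \ S` would join two components of the complement of `T`, whose vertices next to `i` lie in a
single component of the complement of `S`. -/
theorem eq_of_primeIdeal_le (hT : T ∈ minCuts G) (h : primeIdeal G S ≤ primeIdeal G T) :
    S = T := by
  have hsub : S ⊆ T := fun i hi => mem_of_x_mem_primeIdeal (h (x_mem_primeIdeal hi))
  refine hsub.antisymm fun i hi => ?_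
  by_contra hiS
  obtain ⟨u, hu, w, hw, hiu, hiw, huw⟩ := exists_adj_of_mem_minCuts hT hi
  have hu' : u ∉ S := fun h => hu (hsub h)
  have hw' : w ∉ S := fun h => hw (hsub h)
  refine huw (sameComp_of_f_mem_primeIdeal hu hw (h (f_mem_primeIdeal (Or.inr (Or.inr ?_)))))
  rw [sameComp_iff_linked]
  exact (Linked.of_adj hu' hiS hiu.symm).trans (.of_adj hiS hw' hiw)

theorem primeIdeal_erase_le (hi : i ∈ S)
    (h : ¬ ∃ u, u ∉ S ∧ ∃ w, w ∉ S ∧ G.Adj i u ∧ G.Adj i w ∧ ¬ SameComp G S u w) :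
    primeIdeal G (S.erase i) ≤ primeIdeal G S := by
  have heq : {v | v ∉ S.erase i} = insert i {v | v ∉ S} := by
    ext v
    simp only [Finset.mem_erase, Set.mem_insert_iff, Set.mem_ofPred_eq]
    tauto
  refine primeIdeal_le_iff.2 ⟨fun k hk => ?_, fun u w huw => f_mem_primeIdeal ?_⟩
  · have := Finset.mem_of_mem_erase hk
    exact ⟨x_mem_primeIdeal this, y_mem_primeIdeal this⟩
  · by_cases hu : u ∈ S
    · exact Or.inl hu
    by_cases hw : w ∈ S
    · exact Or.inr (Or.inl hw)
    refine Or.inr (Or.inr ?_)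
    rw [sameComp_iff_linked, heq] at huw
    rw [sameComp_iff_linked]
    refine huw.of_insert (fun h => h hi) (fun a ha b hb hia hib => ?_) hu hw
    by_contra hab
    exact h ⟨a, ha, b, hb, hia, hib, fun h => hab (sameComp_iff_linked.1 h)⟩

/-- The set of all vertices whose two variables lie in `Q` works: modulo `Q`, proportionality is
transitive on the remaining, nonzero columns, so it spreads along paths. -/
theorem exists_primeIdeal_le {Q : Ideal (Poly n)} (hQ : Q.IsPrime) (hG : edgeIdeal G ≤ Q) :
    ∃ T, primeIdeal G T ≤ Q := by
  classical
  refine ⟨Finset.univ.filter fun i => x i ∈ Q ∧ y i ∈ Q, primeIdeal_le_iff.2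
    ⟨fun i hi => (Finset.mem_filter.1 hi).2, fun u w huw => ?_⟩⟩
  obtain ⟨hu, huw⟩ := sameComp_iff_linked.1 huw
  induction huw with
  | refl =>
    rw [f_self]
    exact zero_mem _
  | @tail b c hub hbc ih =>
    have hb : ¬ (x b ∈ Q ∧ y b ∈ Q) := by
      simpa using Linked.mem_right ⟨hu, hub⟩
    have ih := ih (sameComp_iff_linked.2 ⟨hu, hub⟩)
    have hbc := edgeIdeal_le_iff.1 hG b c hbc.1
    by_contra hc
    refine hb ⟨(hQ.mem_or_mem ?_).resolve_right hc, (hQ.mem_or_mem ?_).resolve_right hc⟩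
    · have : x b * f u c = x u * f b c + x c * f u b := by simp only [f]; ring
      rw [this]
      exact add_mem (Ideal.mul_mem_left _ _ hbc) (Ideal.mul_mem_left _ _ ih)
    · have : y b * f u c = y u * f b c + y c * f u b := by simp only [f]; ring
      rw [this]
      exact add_mem (Ideal.mul_mem_left _ _ hbc) (Ideal.mul_mem_left _ _ ih)

/-- A set of least cardinality whose ideal lies in `Q` consists of cut points, since any other
vertex could be removed from it. -/
theorem exists_mem_minCuts_primeIdeal_le {Q : Ideal (Poly n)} (hQ : Q.IsPrime)
    (hG : edgeIdeal G ≤ Q) : ∃ S ∈ minCuts G, primeIdeal G S ≤ Q := by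
  obtain ⟨S, hS, hmin⟩ := Set.exists_min_image {T | primeIdeal G T ≤ Q} Finset.card
    (Set.toFinite _) (exists_primeIdeal_le hQ hG)
  refine ⟨S, ?_, hS⟩
  have hcut : ∀ i ∈ S,
      ∃ u, u ∉ S ∧ ∃ w, w ∉ S ∧ G.Adj i u ∧ G.Adj i w ∧ ¬ SameComp G S u w := by
    intro i hi
    by_contra h
    exact (Finset.card_erase_lt_of_mem hi).not_ge
      (hmin _ ((primeIdeal_erase_le hi h).trans hS))
  rcases S.eq_empty_or_nonempty with rfl | ⟨i, hi⟩
  · exact Or.inr rfl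
  obtain ⟨u, hu, w, hw, -, -, huw⟩ := hcut i hi
  refine Or.inl ⟨_, ?_, ⟨i, hi⟩, fun h => hu (h ▸ Finset.mem_univ u), rfl,
    fun j hj => (isCutPoint_iff hj).2 (hcut j hj)⟩
  have : Nontrivial (Comp G {v | v ∉ S}) :=
    ⟨⟨_, _, fun h => huw (sameComp_iff_linked.2 ((mk_eq_mk_iff_linked hu hw).1 h))⟩⟩
  exact Finite.one_lt_card

/-! ### Transversals -/

theorem isDependent_singleton_iff : IsDependent G S {i} ↔ i ∈ S := by
  rw [← not_iff_not, not_isDependent_iff]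
  simp

theorem isDependent_pair_iff (hij : i ≠ j) :
    IsDependent G S {i, j} ↔ i ∈ S ∨ j ∈ S ∨ SameComp G S i j := by
  rw [← not_iff_not, not_isDependent_iff, Set.ncard_pair hij]
  have := @SameComp.symm n G S i j
  have := @SameComp.symm n G S j i
  grind

theorem mem_depSets_iff {B : Finset (Fin n)} :
    B ∈ depSets G S ↔ IsDependent G S (B : Set (Fin n)) :=
  cutMatroid_dep_iff

/-- A set dependent for `T` but not for `S` has one or two elements: independence for `S` bounds its
size by two, and the empty set is never dependent. -/
theorem cases_of_mem_depSets_diff {B : Finset (Fin n)} (h : B ∈ depSets G T \ depSets G S) :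
    (∃ k ∈ T, B = {k}) ∨
      ∃ i j, i < j ∧ B = {i, j} ∧ (i ∈ T ∨ j ∈ T ∨ SameComp G T i j) := by
  obtain ⟨hT, hS⟩ := h
  rw [mem_depSets_iff] at hT hS
  have hcard : B.card ≤ 2 := by
    have := (not_isDependent_iff.1 hS).2.2
    rwa [Set.ncard_coe_finset] at this
  have h0 : B.card ≠ 0 := by
    intro h
    rw [Finset.card_eq_zero.1 h] at hT
    exact (not_isDependent_iff (G := G) (S := T) (B := ∅)).2 (by simp) (by simpa using hT)
  obtain h1 | h2 : B.card = 1 ∨ B.card = 2 := by omega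
  · obtain ⟨k, rfl⟩ := Finset.card_eq_one.1 h1
    rw [Finset.coe_singleton, isDependent_singleton_iff] at hT
    exact Or.inl ⟨k, hT, rfl⟩
  · obtain ⟨i, j, hij, rfl⟩ := Finset.card_eq_two.1 h2
    rcases lt_or_gt_of_ne hij with hlt | hlt
    · rw [Finset.coe_pair, isDependent_pair_iff hij] at hT
      exact Or.inr ⟨i, j, hlt, rfl, hT⟩
    · rw [Finset.pair_comm, Finset.coe_pair, isDependent_pair_iff hij.symm] at hT
      exact Or.inr ⟨j, i, hlt, Finset.pair_comm _ _, hT⟩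

theorem transversalIdeal_le_primeIdeal (hT : T ∈ minCuts G) (hTS : T ≠ S) :
    transversalIdeal G S ≤ primeIdeal G T := by
  rw [transversalIdeal, Ideal.span_le]
  rintro _ ⟨A, hA, C, D, -, hCD, rfl⟩
  obtain ⟨B, hBA, hB⟩ := hA.2 _ ⟨T, hT, hTS, rfl⟩
  have hBA : B ∈ A := hBA
  rw [g]
  rcases cases_of_mem_depSets_diff hB with ⟨k, hk, rfl⟩ | ⟨i, j, hij, rfl, h⟩
  · refine Ideal.mul_mem_right _ _ ?_
    have hkA : k ∈ C ∪ D := by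
      rw [hCD]
      simpa [singles] using hBA
    rcases Finset.mem_union.1 hkA with hk' | hk'
    · exact Ideal.mul_mem_right _ _ (Ideal.mem_of_dvd _
        (Finset.dvd_prod_of_mem _ hk') (x_mem_primeIdeal hk))
    · exact Ideal.mul_mem_left _ _ (Ideal.mem_of_dvd _
        (Finset.dvd_prod_of_mem _ hk') (y_mem_primeIdeal hk))
  · refine Ideal.mul_mem_left _ _ ?_
    have hp : (i, j) ∈ pairs A := by simp [pairs, hij, hBA]
    exact Ideal.mem_of_dvd _ (Finset.dvd_prod_of_mem (fun p : Fin n × Fin n => f p.1 p.2) hp)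
      (f_mem_primeIdeal h)

/-- If `Q` contained no `primeIdeal G T` with `T ≠ S`, it would contain `primeIdeal G S`, and the
sets of one or two vertices witnessing the former would form a transversal one of whose products
avoids `Q`. -/
theorem exists_ne_primeIdeal_le {Q : Ideal (Poly n)} (hQ : Q.IsPrime)
    (h : edgeIdeal G ⊔ transversalIdeal G S ≤ Q) :
    ∃ T ∈ minCuts G, T ≠ S ∧ primeIdeal G T ≤ Q := by
  classical
  by_contra! hcon
  have hSQ : primeIdeal G S ≤ Q := by
    obtain ⟨T, hT, hTQ⟩ := exists_mem_minCuts_primeIdeal_le hQ (le_sup_left.trans h)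
    by_cases hTS : T = S
    · exact hTS ▸ hTQ
    · exact absurd hTQ (hcon T hT hTS)
  let indep : Finset (Fin n) → Prop := fun B =>
    (∀ k, B = {k} → x k ∈ Q → y k ∉ Q) ∧ ∀ i j, B = {i, j} → i < j → f i j ∉ Q
  let A : Finset (Finset (Fin n)) :=
    Finset.univ.filter fun B => indep B ∧ B ∈ ⋃₀ diffFamily G S
  have hA : A ∈ transversals G S := by
    refine ⟨fun B hB => (Finset.mem_filter.1 hB).2.2, ?_⟩
    rintro _ ⟨T, hT, hTS, rfl⟩
    suffices ∃ B, B ∈ depSets G T ∧ B ∉ depSets G S ∧ indep B by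
      obtain ⟨B, hBT, hBS, hB⟩ := this
      exact ⟨B, Finset.mem_filter.2 ⟨Finset.mem_univ B, hB, _, ⟨T, hT, hTS, rfl⟩, hBT, hBS⟩,
        hBT, hBS⟩
    have hTQ := hcon T hT hTS
    rw [primeIdeal_le_iff, not_and_or] at hTQ
    rcases hTQ with hTQ | hTQ
    · push Not at hTQ
      obtain ⟨k, hk, hkQ⟩ := hTQ
      have hkS : k ∉ S := fun h => hkQ (hSQ (x_mem_primeIdeal h)) (hSQ (y_mem_primeIdeal h))
      refine ⟨{k}, ?_, ?_, fun l hl => ?_, fun i j hij hlt => ?_⟩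
      · rwa [mem_depSets_iff, Finset.coe_singleton, isDependent_singleton_iff]
      · rwa [mem_depSets_iff, Finset.coe_singleton, isDependent_singleton_iff]
      · rwa [← Finset.singleton_injective hl]
      · have := congrArg Finset.card hij
        rw [Finset.card_singleton, Finset.card_pair hlt.ne] at this
        omega
    · push Not at hTQ
      obtain ⟨a, b, hab, habQ⟩ := hTQ
      have hne : a ≠ b := by
        rintro rfl
        exact habQ (f_self a ▸ zero_mem _)
      refine ⟨{a, b}, ?_, ?_, fun l hl => ?_, fun i j hij hlt => ?_⟩
      · rw [mem_depSets_iff, Finset.coe_pair, isDependent_pair_iff hne]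
        exact Or.inr (Or.inr hab)
      · rw [mem_depSets_iff, Finset.coe_pair, isDependent_pair_iff hne]
        exact fun h => habQ (hSQ (f_mem_primeIdeal h))
      · have := congrArg Finset.card hl
        rw [Finset.card_singleton, Finset.card_pair hne] at this
        omega
      · obtain ⟨rfl, rfl⟩ | ⟨rfl, rfl⟩ : a = i ∧ b = j ∨ a = j ∧ b = i := by
          have ha : a ∈ ({i, j} : Finset (Fin n)) := hij ▸ by simp
          have hb : b ∈ ({i, j} : Finset (Fin n)) := hij ▸ by simp
          simp only [Finset.mem_insert, Finset.mem_singleton] at ha hb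
          grind
        · exact habQ
        · rw [f_swap]
          exact fun h => habQ (neg_mem_iff.1 h)
  have hindep : ∀ B ∈ A, indep B := fun B hB => (Finset.mem_filter.1 hB).2.1
  have hg : g A ((singles A).filter fun k => x k ∉ Q) ((singles A).filter fun k => ¬ x k ∉ Q) ∈ Q :=
    h (Ideal.mem_sup_right (Ideal.subset_span ⟨A, hA, _, _,
      Finset.disjoint_filter_filter_not _ _ _, Finset.filter_union_filter_not_eq _ _, rfl⟩))
  rw [g] at hg
  rcases hQ.mem_or_mem hg with hg | hg
  · rcases hQ.mem_or_mem hg with hg | hg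
    · obtain ⟨k, hk, hkQ⟩ := hQ.prod_mem_iff.1 hg
      exact (Finset.mem_filter.1 hk).2 hkQ
    · obtain ⟨k, hk, hkQ⟩ := hQ.prod_mem_iff.1 hg
      obtain ⟨hk, hk'⟩ := Finset.mem_filter.1 hk
      exact (hindep {k} (Finset.mem_filter.1 hk).2).1 k rfl (not_not.1 hk') hkQ
  · obtain ⟨p, hp, hpQ⟩ := hQ.prod_mem_iff.1 hg
    obtain ⟨-, hlt, hp⟩ := Finset.mem_filter.1 hp
    exact (hindep _ hp).2 _ _ rfl hlt hpQ

end Primes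

end BinomialEdge

theorem theorem3p2 {n : ℕ} (G : SimpleGraph (Fin n)) (hG : G.Connected)
    (S : Finset (Fin n)) (hS : S ∈ BinomialEdge.minCuts G) :
    (BinomialEdge.edgeIdeal G).colon (BinomialEdge.primeIdeal G S : Set (BinomialEdge.Poly n)) =
      (BinomialEdge.edgeIdeal G ⊔ BinomialEdge.transversalIdeal G S).radical := by
  open BinomialEdge in
  apply le_antisymm
  · intro a ha
    rw [Ideal.radical_eq_sInf, Ideal.mem_sInf]
    rintro Q ⟨hle, hQ⟩
    obtain ⟨T, hT, hTS, hTQ⟩ := exists_ne_primeIdeal_le hQ hle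
    obtain ⟨p, hpS, hpT⟩ := SetLike.not_le_iff_exists.1 fun h =>
      hTS (eq_of_primeIdeal_le (G := G) hT h).symm
    exact hTQ (((primeIdeal_isPrime G T).mem_or_mem
      (edgeIdeal_le_primeIdeal G T (Submodule.mem_colon.1 ha p hpS))).resolve_right hpT)
  · intro a ha
    rw [Submodule.mem_colon]
    intro p hp
    rw [smul_eq_mul, ← (edgeIdeal_isRadical G).radical, Ideal.radical_eq_sInf, Ideal.mem_sInf]
    rintro Q ⟨hle, hQ⟩
    obtain ⟨T, hT, hTQ⟩ := exists_mem_minCuts_primeIdeal_le hQ hle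
    by_cases hTS : T = S
    · exact Ideal.mul_mem_left _ _ (hTQ (hTS ▸ hp))
    · have hle' := sup_le (edgeIdeal_le_primeIdeal G T) (transversalIdeal_le_primeIdeal hT hTS)
      exact Ideal.mul_mem_right _ _
        (hTQ ((primeIdeal_isPrime G T).isRadical.radical_le_iff.2 hle' ha))
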